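/- **Setting.** Let $H=\bigcup_{j=1}^n(c_j,d_j)\subset\mathbb R$, where $c_j<d_j$ and the closed intervals $[c_j,d_j]$ are pairwise disjoint, and let $\mathcal B$ be a nonempty finite index set. For an integer $m\ge 1$, $C^m(\bar H)$ is the set of $f:\bar H\to\mathbb R$ that are $C^m$ on $H$ and such that $f$ and its derivatives $D^kf$ on $H$, $k\le m$, extend continuously to $\bar H$ (these extensions are again denoted $f$, $D^kf$). Assume: (H6.1) For each $\beta\in\mathcal B$: $b_\beta,\theta_\beta\in C^m(\bar H)$, $b_\beta>0$ on $\bar H$ and $\theta_\beta(H)\subset H$. There are an integer $\mu\ge1$ and a real $\kappa<1$ with $|\theta_\omega(x)-\theta_\omega(y)|\le\kappa|x-y|$ for all $\omega\in\mathcal B^\mu$ and all $x,y\in\bar H$. Here, for $\omega=(\beta_1,\dots,\beta_\nu)\in\mathcal B^\nu$, $\theta_\omega=\theta_{\beta_\nu}\circ\cdots\circ\theta_{\beta_1}$ and $b_\omega(x)=b_{\beta_\nu}\big((\theta_{\beta_{\nu-1}}\circ\cdots\circ\theta_{\beta_1})(x)\big)\cdots b_{\beta_2}(\theta_{\beta_1}(x))\,b_{\beta_1}(x)$.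 Put $\epsilon_0=1$ and, for $\nu\ge1$, $$\epsilon_\nu=\sup\Big\{\frac{|\theta_\omega(x)-\theta_\omega(y)|}{|x-y|}:\ \omega\in\mathcal B^\nu,\ x,y\in H,\ x\ne y\Big\},\qquad C_1=\sup_{\beta\in\mathcal B,\,x\in H}\frac{|Db_\beta(x)|}{b_\beta(x)},$$ and, if $m\ge2$, $$C_2=\sup_{\beta\in\mathcal B,\,x\in H}\frac{|D^2b_\beta(x)|}{b_\beta(x)},\qquad M_0=\sup_{\beta\in\mathcal B,\,x\in\bar H}|D^2\theta_\beta(x)|.$$ **Theorem.** Let $s>0$ and let $v_s\in C^m(\bar H)$ be a strictly positive (on $\bar H$) eigenvector, with whatever normalization, of $(L_sf)(x)=\sum_{\beta\in\mathcal B}b_\beta(x)^s f(\theta_\beta(x))$, that is, $L_sv_s=r\,v_s$ on $\bar H$ for some real $r$. Then the suprema above are finite, $\sum_k\epsilon_k<\infty$ and $\sum_k\epsilon_k^2<\infty$, and: 1. For all $x\in\bar H$, $$\frac{|Dv_s(x)|}{v_s(x)}\le s\,C_1\sum_{k=0}^\infty\epsilon_k .$$ 2. If $\delta\in\{0,1\}$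 and $(-1)^\delta Db_\omega(x)/b_\omega(x)\le0$ for all $\nu\ge1$, $\omega\in\mathcal B^\nu$ and $x\in\bar H$, then $(-1)^\delta Dv_s(x)\le0$ for all $x\in\bar H$. 3. If $m\ge2$, then for all $x\in\bar H$, $$\frac{D^2v_s(x)}{v_s(x)}\le s^2C_1^2\Big(\sum_{k=0}^\infty\epsilon_k\Big)^2+s\Big(\sum_{k=0}^\infty\epsilon_k^2\Big)\Big[C_2+C_1M_0\sum_{k=0}^\infty\epsilon_k\Big]$$ and $$\frac{D^2v_s(x)}{v_s(x)}\ge-s\Big(\sum_{k=0}^\infty\epsilon_k^2\Big)\Big[(C_2+C_1^2)+C_1M_0\sum_{k=0}^\infty\epsilon_k\Big].$$ -/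

import Mathlib

open Set Filter Topology

noncomputable section

namespace IFS

/-- Membership in `C^m(closure H)` for an open set `H` of reals: `f` is `C^m` on `H`, and `f`
together with all its derivatives of order at most `m` on `H` extends continuously to `closure H`;
the values of `f` on the boundary of `H` are those of the continuous extension. -/
structure IsCm (m : ℕ) (H : Set ℝ) (f : ℝ → ℝ) : Prop where
  contDiffOn : ContDiffOn ℝ m f H
  continuousOn : ContinuousOn f (closure H)
  extends_deriv : ∀ k ≤ m, ∃ g : ℝ → ℝ,
    ContinuousOn g (closure H) ∧ EqOn (iteratedDeriv k f) g H

/-- `D^k f` on `closure H`: the extension by continuity of the `k`-th derivative of `f` on the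
open set `H`. -/
def derivBar (H : Set ℝ) (k : ℕ) (f : ℝ → ℝ) : ℝ → ℝ :=
  extendFrom H (iteratedDeriv k f)

variable {B : Type*}

/-- `θ_ω = θ_{β_ν} ∘ ⋯ ∘ θ_{β_1}` for the word `ω = [β_1, …, β_ν]`. -/
def thetaWord (θ : B → ℝ → ℝ) : List B → ℝ → ℝ
  | [], x => x
  | β :: ω, x => thetaWord θ ω (θ β x)

/-- `b_ω(x) = b_{β_ν}((θ_{β_{ν-1}} ∘ ⋯ ∘ θ_{β_1})(x)) ⋯ b_{β_2}(θ_{β_1}(x)) b_{β_1}(x)` for the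
word `ω = [β_1, …, β_ν]`. -/
def bWord (b θ : B → ℝ → ℝ) : List B → ℝ → ℝ
  | [], _ => 1
  | β :: ω, x => bWord b θ ω (θ β x) * b β x

/-- The operator `(L_s f)(x) = ∑_β b_β(x)^s f(θ_β(x))`. -/
def transferOp [Fintype B] (b θ : B → ℝ → ℝ) (s : ℝ) (f : ℝ → ℝ) : ℝ → ℝ :=
  fun x => ∑ β, b β x ^ s * f (θ β x)

/-- The regularity and contraction hypothesis on the iterated function system: the `b_β` and
`θ_β` are in `C^m(closure H)`, `b_β > 0` on `closure H`, `θ_β(H) ⊆ H`, and all compositions of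
some fixed length `μ ≥ 1` contract distances on `closure H` by a common factor `κ < 1`. -/
structure Hypothesis (m : ℕ) (H : Set ℝ) (b θ : B → ℝ → ℝ) : Prop where
  b_mem : ∀ β, IsCm m H (b β)
  theta_mem : ∀ β, IsCm m H (θ β)
  b_pos : ∀ β, ∀ x ∈ closure H, 0 < b β x
  mapsTo : ∀ β, MapsTo (θ β) H H
  contraction : ∃ μ : ℕ, 1 ≤ μ ∧ ∃ κ : ℝ, κ < 1 ∧ ∀ ω : List B, ω.length = μ →
    ∀ x ∈ closure H, ∀ y ∈ closure H, |thetaWord θ ω x - thetaWord θ ω y| ≤ κ * |x - y|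

/-- The difference quotients of the maps `θ_ω` over words `ω` of length `ν`. -/
def epsSet (H : Set ℝ) (θ : B → ℝ → ℝ) (ν : ℕ) : Set ℝ :=
  {q | ∃ ω : List B, ω.length = ν ∧ ∃ x ∈ H, ∃ y ∈ H, x ≠ y ∧
    q = |thetaWord θ ω x - thetaWord θ ω y| / |x - y|}

/-- `ε_0 = 1` and, for `ν ≥ 1`, `ε_ν` is the largest Lipschitz constant on `H` of the maps `θ_ω`,
`ω` of length `ν`. -/
def eps (H : Set ℝ) (θ : B → ℝ → ℝ) (ν : ℕ) : ℝ :=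
  if ν = 0 then 1 else sSup (epsSet H θ ν)

/-- The values `|D^k b_β(x)| / b_β(x)` for `β ∈ B` and `x ∈ H`. -/
def CSet (H : Set ℝ) (b : B → ℝ → ℝ) (k : ℕ) : Set ℝ :=
  {q | ∃ β, ∃ x ∈ H, q = |derivBar H k (b β) x| / b β x}

/-- `C_k = sup { |D^k b_β(x)| / b_β(x) : β ∈ B, x ∈ H }`. -/
def C (H : Set ℝ) (b : B → ℝ → ℝ) (k : ℕ) : ℝ := sSup (CSet H b k)

/-- The values `|D² θ_β(x)|` for `β ∈ B` and `x ∈ closure H`. -/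
def M₀Set (H : Set ℝ) (θ : B → ℝ → ℝ) : Set ℝ :=
  {q | ∃ β, ∃ x ∈ closure H, q = |derivBar H 2 (θ β) x|}

/-- `M_0 = sup { |D² θ_β(x)| : β ∈ B, x ∈ closure H }`. -/
def M₀ (H : Set ℝ) (θ : B → ℝ → ℝ) : ℝ := sSup (M₀Set H θ)

end IFS

end

/-! Iterating the eigenvalue equation ν times gives r^ν v = ∑ b_ω^s (v ∘ θ_ω), the sum running over
words of length ν. Each summand is exp A_ω with A_ω = s log b_ω + log (v ∘ θ_ω)
(`pow_mul_eq_sum_exp`). Differentiation shows that v'/v is the mean of A_ω', and v''/v the mean of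
A_ω'' + (A_ω')², with weights proportional to exp A_ω. Bounds uniform in ω therefore pass to v.

By the product formula, log b_ω is a sum of terms log b_β ∘ θ_p over the proper prefixes p of ω, so
its derivative is at most C_1 ∑ ε_k. Its second derivative also involves θ_p'', which the chain rule
bounds by M_0 times a convolution of ε² with ε (`abs_deriv_deriv_word_le`). Summing over prefix
lengths gives the Cauchy product (∑ ε²)(∑ ε).

The derivatives of log (v ∘ θ_ω) carry factors ε_ν, ε_ν² or the convolution at ν, all tending to 0.
Any a priori bounds on the derivatives of log v thus disappear as ν → ∞, and only constants of the
system remain.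

The series converge because ε is submultiplicative and some ε_μ is less than 1. Finiteness of the
ε_ν rests on the positive gaps between the intervals. The estimates are proved on the open set H and
extended to its closure by continuity. -/

noncomputable section

namespace IFS

/-! ### Derivatives of compositions, logarithms and sums of exponentials; extension to the closure.
-/

section Calculus

variable {H : Set ℝ} {f g : ℝ → ℝ} {x : ℝ}

theorem iteratedDeriv_two_eq : iteratedDeriv 2 f = deriv (deriv f) := by
  rw [iteratedDeriv_succ, iteratedDeriv_one]

theorem hasDerivAt_of_contDiffOn (hH : IsOpen H) (hf : ContDiffOn ℝ 1 f H) (hx : x ∈ H) :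
    HasDerivAt f (deriv f x) x :=
  ((hf.differentiableOn one_ne_zero).differentiableAt (hH.mem_nhds hx)).hasDerivAt

theorem hasDerivAt_deriv_of_contDiffOn (hH : IsOpen H) (hf : ContDiffOn ℝ 2 f H) (hx : x ∈ H) :
    HasDerivAt (deriv f) (deriv (deriv f) x) x :=
  hasDerivAt_of_contDiffOn hH (hf.deriv_of_isOpen hH (by norm_num [one_add_one_eq_two])) hx

theorem deriv_comp_of_mapsTo (hH : IsOpen H) (hf : ContDiffOn ℝ 1 f H) (hg : ContDiffOn ℝ 1 g H)
    (hgH : MapsTo g H H) (hx : x ∈ H) :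
    deriv (fun y => f (g y)) x = deriv f (g x) * deriv g x :=
  ((hasDerivAt_of_contDiffOn hH hf (hgH hx)).comp x (hasDerivAt_of_contDiffOn hH hg hx)).deriv

theorem deriv_deriv_comp_of_mapsTo (hH : IsOpen H) (hf : ContDiffOn ℝ 2 f H)
    (hg : ContDiffOn ℝ 2 g H) (hgH : MapsTo g H H) (hx : x ∈ H) :
    deriv (deriv fun y => f (g y)) x =
      deriv (deriv f) (g x) * deriv g x ^ 2 + deriv f (g x) * deriv (deriv g) x := by
  have hf1 := hf.of_le one_le_two
  have hg1 := hg.of_le one_le_two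
  have h : EqOn (deriv fun y => f (g y)) (fun y => deriv f (g y) * deriv g y) H :=
    fun y hy => deriv_comp_of_mapsTo hH hf1 hg1 hgH hy
  rw [h.deriv hH hx]
  have h1 : HasDerivAt (fun y => deriv f (g y)) (deriv (deriv f) (g x) * deriv g x) x :=
    (hasDerivAt_deriv_of_contDiffOn hH hf (hgH hx)).comp x (hasDerivAt_of_contDiffOn hH hg1 hx)
  refine (h1.mul (hasDerivAt_deriv_of_contDiffOn hH hg hx)).deriv.trans ?_
  ring

theorem deriv_add_of_contDiffOn (hH : IsOpen H) (hf : ContDiffOn ℝ 1 f H)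
    (hg : ContDiffOn ℝ 1 g H) (hx : x ∈ H) :
    deriv (fun y => f y + g y) x = deriv f x + deriv g x :=
  ((hasDerivAt_of_contDiffOn hH hf hx).add (hasDerivAt_of_contDiffOn hH hg hx)).deriv

theorem deriv_deriv_add_of_contDiffOn (hH : IsOpen H) (hf : ContDiffOn ℝ 2 f H)
    (hg : ContDiffOn ℝ 2 g H) (hx : x ∈ H) :
    deriv (deriv fun y => f y + g y) x = deriv (deriv f) x + deriv (deriv g) x := by
  have h : EqOn (deriv fun y => f y + g y) (fun y => deriv f y + deriv g y) H := fun y hy =>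
    deriv_add_of_contDiffOn hH (hf.of_le one_le_two) (hg.of_le one_le_two) hy
  rw [h.deriv hH hx]
  exact ((hasDerivAt_deriv_of_contDiffOn hH hf hx).add
    (hasDerivAt_deriv_of_contDiffOn hH hg hx)).deriv

theorem deriv_log_of_contDiffOn (hH : IsOpen H) (hf : ContDiffOn ℝ 1 f H)
    (hpos : ∀ y ∈ H, 0 < f y) (hx : x ∈ H) :
    deriv (fun y => Real.log (f y)) x = deriv f x / f x :=
  ((hasDerivAt_of_contDiffOn hH hf hx).log (hpos x hx).ne').deriv

theorem deriv_deriv_log_of_contDiffOn (hH : IsOpen H) (hf : ContDiffOn ℝ 2 f H)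
    (hpos : ∀ y ∈ H, 0 < f y) (hx : x ∈ H) :
    deriv (deriv fun y => Real.log (f y)) x =
      deriv (deriv f) x / f x - (deriv f x / f x) ^ 2 := by
  have hf1 := hf.of_le one_le_two
  have h : EqOn (deriv fun y => Real.log (f y)) (fun y => deriv f y / f y) H := fun y hy =>
    deriv_log_of_contDiffOn hH hf1 hpos hy
  rw [h.deriv hH hx]
  have hne := (hpos x hx).ne'
  have := (hasDerivAt_deriv_of_contDiffOn hH hf hx).div (hasDerivAt_of_contDiffOn hH hf1 hx) hne
  refine this.deriv.trans ?_
  field_simp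

/-- In exponential form each summand is its own weight: differentiating multiplies it by the
derivative of the exponent. -/
theorem mul_deriv_eq_sum_exp {ι : Type*} (hH : IsOpen H) {W : Finset ι} {A : ι → ℝ → ℝ} {R : ℝ}
    (hA : ∀ i ∈ W, ContDiffOn ℝ 1 (A i) H) (hf : ContDiffOn ℝ 1 f H)
    (h : ∀ y ∈ H, R * f y = ∑ i ∈ W, Real.exp (A i y)) (hx : x ∈ H) :
    R * deriv f x = ∑ i ∈ W, Real.exp (A i x) * deriv (A i) x := by
  have h1 : deriv (fun y => R * f y) x = R * deriv f x :=
    ((hasDerivAt_of_contDiffOn hH hf hx).const_mul R).deriv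
  rw [← h1, EqOn.deriv h hH hx]
  exact (HasDerivAt.fun_sum fun i hi => (hasDerivAt_of_contDiffOn hH (hA i hi) hx).exp).deriv

theorem mul_deriv_deriv_eq_sum_exp {ι : Type*} (hH : IsOpen H) {W : Finset ι} {A : ι → ℝ → ℝ}
    {R : ℝ} (hA : ∀ i ∈ W, ContDiffOn ℝ 2 (A i) H) (hf : ContDiffOn ℝ 2 f H)
    (h : ∀ y ∈ H, R * f y = ∑ i ∈ W, Real.exp (A i y)) (hx : x ∈ H) :
    R * deriv (deriv f) x =
      ∑ i ∈ W, Real.exp (A i x) * (deriv (deriv (A i)) x + deriv (A i) x ^ 2) := by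
  have h1 : deriv (fun y => R * deriv f y) x = R * deriv (deriv f) x :=
    ((hasDerivAt_deriv_of_contDiffOn hH hf hx).const_mul R).deriv
  have h2 : EqOn (fun y => R * deriv f y) (fun y => ∑ i ∈ W, Real.exp (A i y) * deriv (A i) y) H :=
    fun y hy => mul_deriv_eq_sum_exp hH (fun i hi => (hA i hi).of_le one_le_two)
      (hf.of_le one_le_two) h hy
  rw [← h1, h2.deriv hH hx]
  have h3 := HasDerivAt.fun_sum (u := W) fun i hi =>
    ((hasDerivAt_of_contDiffOn hH ((hA i hi).of_le one_le_two) hx).exp).mul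
      (hasDerivAt_deriv_of_contDiffOn hH (hA i hi) hx)
  refine h3.deriv.trans (Finset.sum_congr rfl fun i _ => ?_)
  ring

/-- When q is nonzero, p / q is a mean of the a i with weights e i, so it inherits every common
bound. -/
theorem le_mul_of_weighted_sum {ι : Type*} {W : Finset ι} {e a : ι → ℝ} {R p q k : ℝ} (hR : 0 < R)
    (he : ∀ i ∈ W, 0 ≤ e i) (hp : R * p = ∑ i ∈ W, e i * a i) (hq : R * q = ∑ i ∈ W, e i)
    (ha : ∀ i ∈ W, a i ≤ k) : p ≤ k * q := by
  refine le_of_mul_le_mul_left ?_ hR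
  calc R * p = ∑ i ∈ W, e i * a i := hp
    _ ≤ ∑ i ∈ W, e i * k :=
      Finset.sum_le_sum fun i hi => mul_le_mul_of_nonneg_left (ha i hi) (he i hi)
    _ = R * (k * q) := by rw [← Finset.sum_mul, ← hq]; ring

theorem mul_le_of_weighted_sum {ι : Type*} {W : Finset ι} {e a : ι → ℝ} {R p q k : ℝ} (hR : 0 < R)
    (he : ∀ i ∈ W, 0 ≤ e i) (hp : R * p = ∑ i ∈ W, e i * a i) (hq : R * q = ∑ i ∈ W, e i)
    (ha : ∀ i ∈ W, k ≤ a i) : k * q ≤ p := by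
  have := le_mul_of_weighted_sum (p := -p) (a := fun i => -a i) (k := -k) hR he
    (by simp [hp]) hq fun i hi => neg_le_neg (ha i hi)
  linarith

/-- Limits along H are unique, so `extendFrom` must agree with any continuous extension g. -/
theorem IsCm.exists_continuousOn_derivBar {m k : ℕ} (hf : IsCm m H f) (hk : k ≤ m) :
    ContinuousOn (derivBar H k f) (closure H) ∧ EqOn (derivBar H k f) (iteratedDeriv k f) H := by
  obtain ⟨g, hg, hfg⟩ := hf.extends_deriv k hk
  have h : EqOn (derivBar H k f) g (closure H) := fun x hx =>
    extendFrom_eq hx (((hg x hx).mono subset_closure).congr' (hfg.eventuallyEq_nhdsWithin.symm))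
  exact ⟨hg.congr h, (h.mono subset_closure).trans hfg.symm⟩

theorem IsCm.continuousOn_derivBar {m k : ℕ} (hf : IsCm m H f) (hk : k ≤ m) :
    ContinuousOn (derivBar H k f) (closure H) :=
  (hf.exists_continuousOn_derivBar hk).1

theorem IsCm.derivBar_one {m : ℕ} (hf : IsCm m H f) (hm : 1 ≤ m) (hx : x ∈ H) :
    derivBar H 1 f x = deriv f x := by
  rw [(hf.exists_continuousOn_derivBar hm).2 hx, iteratedDeriv_one]

theorem IsCm.derivBar_two {m : ℕ} (hf : IsCm m H f) (hm : 2 ≤ m) (hx : x ∈ H) :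
    derivBar H 2 f x = deriv (deriv f) x := by
  rw [(hf.exists_continuousOn_derivBar hm).2 hx, iteratedDeriv_two_eq]

theorem IsCm.contDiffOn_one {m : ℕ} (hf : IsCm m H f) (hm : 1 ≤ m) : ContDiffOn ℝ 1 f H :=
  hf.contDiffOn.of_le (by exact_mod_cast hm)

theorem IsCm.contDiffOn_two {m : ℕ} (hf : IsCm m H f) (hm : 2 ≤ m) : ContDiffOn ℝ 2 f H :=
  hf.contDiffOn.of_le (by exact_mod_cast hm)

/-- Serves the products b_ω, for which C¹ regularity on H is enough and extension to the boundary is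
never needed. -/
theorem derivBar_one_of_contDiffOn (hH : IsOpen H) (hf : ContDiffOn ℝ 1 f H) (hx : x ∈ H) :
    derivBar H 1 f x = deriv f x := by
  rw [derivBar, iteratedDeriv_one]
  exact extendFrom_extends (hf.continuousOn_deriv_of_isOpen hH le_rfl) x hx

/-- A function continuous on the compact closure of `H` is bounded there. -/
theorem exists_abs_le_of_continuousOn (hc : IsCompact (closure H))
    (hf : ContinuousOn f (closure H)) : ∃ K, 0 ≤ K ∧ ∀ x ∈ closure H, |f x| ≤ K := by
  obtain ⟨K, hK⟩ := hc.exists_bound_of_continuousOn hf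
  exact ⟨max K 0, le_max_right _ _, fun x hx => (hK x hx).trans (le_max_left _ _)⟩

theorem le_on_closure (hf : ContinuousOn f (closure H)) (hg : ContinuousOn g (closure H))
    (h : ∀ x ∈ H, f x ≤ g x) : ∀ x ∈ closure H, f x ≤ g x := fun _ hx =>
  ContinuousWithinAt.closure_le hx ((hf _ hx).mono subset_closure) ((hg _ hx).mono subset_closure) h

end Calculus

/-! ### Summability of submultiplicative sequences. -/

section Series

/-- A submultiplicative sequence with some term less than `1` is summable. -/
theorem summable_of_submultiplicative {e : ℕ → ℝ} (he : ∀ n, 0 ≤ e n)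
    (hmul : ∀ a b, e (a + b) ≤ e a * e b) {N : ℕ} (hN : e N < 1) : Summable e := by
  -- With S_n the partial sums, S_n ≤ S_(N+n) ≤ S_N + e_N S_n; solving for S_n gives the constant.
  refine summable_of_sum_range_le (c := (∑ i ∈ Finset.range N, e i) / (1 - e N)) he fun n => ?_
  rw [le_div_iff₀ (by linarith)]
  have h1 : ∑ i ∈ Finset.range n, e i ≤ ∑ i ∈ Finset.range (N + n), e i :=
    Finset.sum_le_sum_of_subset_of_nonneg (Finset.range_mono (by omega)) fun i _ _ => he i
  rw [Finset.sum_range_add] at h1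
  have h2 : ∑ i ∈ Finset.range n, e (N + i) ≤ e N * ∑ i ∈ Finset.range n, e i := by
    rw [Finset.mul_sum]
    exact Finset.sum_le_sum fun i _ => hmul _ _
  linarith

end Series

/-! ### Words: contraction factors and derivatives of θ_ω and log b_ω. -/

section Words

variable {B : Type*} {H : Set ℝ} {b θ : B → ℝ → ℝ}

theorem thetaWord_append (p q : List B) (x : ℝ) :
    thetaWord θ (p ++ q) x = thetaWord θ q (thetaWord θ p x) := by
  induction p generalizing x with
  | nil => rfl
  | cons β p ih => exact ih _

/-- The definition peels off the first letter. Peeling off the last one instead isolates a factor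
b_β ∘ θ_p, whose derivatives are controlled by ε at the length of p. -/
theorem bWord_snoc (p : List B) (β : B) (x : ℝ) :
    bWord b θ (p ++ [β]) x = b β (thetaWord θ p x) * bWord b θ p x := by
  induction p generalizing x with
  | nil => simp [bWord, thetaWord]
  | cons γ p ih =>
    simp only [List.cons_append, bWord, thetaWord, ih]
    ring

theorem mapsTo_thetaWord (h : ∀ β, MapsTo (θ β) H H) (ω : List B) :
    MapsTo (thetaWord θ ω) H H := by
  induction ω with
  | nil => exact mapsTo_id H
  | cons β ω ih => exact ih.comp (h β)

theorem contDiffOn_thetaWord {n : WithTop ℕ∞} (hθ : ∀ β, ContDiffOn ℝ n (θ β) H)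
    (h : ∀ β, MapsTo (θ β) H H) (ω : List B) : ContDiffOn ℝ n (thetaWord θ ω) H := by
  induction ω with
  | nil => exact contDiffOn_id
  | cons β ω ih => exact ih.comp (hθ β) (h β)

theorem bWord_pos (hb : ∀ β, ∀ x ∈ H, 0 < b β x) (h : ∀ β, MapsTo (θ β) H H) (ω : List B) :
    ∀ x ∈ H, 0 < bWord b θ ω x := by
  induction ω with
  | nil => exact fun _ _ => one_pos
  | cons β ω ih => exact fun x hx => mul_pos (ih _ (h β hx)) (hb β x hx)

theorem contDiffOn_bWord {n : WithTop ℕ∞} (hb : ∀ β, ContDiffOn ℝ n (b β) H)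
    (hθ : ∀ β, ContDiffOn ℝ n (θ β) H) (h : ∀ β, MapsTo (θ β) H H) (ω : List B) :
    ContDiffOn ℝ n (bWord b θ ω) H := by
  induction ω with
  | nil => exact contDiffOn_const
  | cons β ω ih => exact (ih.comp (hθ β) (h β)).mul (hb β)

theorem abs_thetaWord_sub_le {L : ℝ} (hL : 0 ≤ L) (h : ∀ β, MapsTo (θ β) H H)
    (hLip : ∀ β, ∀ x ∈ H, ∀ y ∈ H, |θ β x - θ β y| ≤ L * |x - y|) (ω : List B) :
    ∀ x ∈ H, ∀ y ∈ H, |thetaWord θ ω x - thetaWord θ ω y| ≤ L ^ ω.length * |x - y| := by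
  induction ω with
  | nil => simp [thetaWord]
  | cons β ω ih =>
    intro x hx y hy
    calc _ ≤ L ^ ω.length * |θ β x - θ β y| := ih _ (h β hx) _ (h β hy)
      _ ≤ L ^ ω.length * (L * |x - y|) := by gcongr; exact hLip β x hx y hy
      _ = _ := by rw [List.length_cons]; ring

/-- Without boundedness the real `sSup` would be the junk value 0 and would bound nothing. -/
theorem bddAbove_epsSet {L : ℝ} (hL : 0 ≤ L) (h : ∀ β, MapsTo (θ β) H H)
    (hLip : ∀ β, ∀ x ∈ H, ∀ y ∈ H, |θ β x - θ β y| ≤ L * |x - y|) (ν : ℕ) :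
    BddAbove (epsSet H θ ν) := by
  refine ⟨L ^ ν, ?_⟩
  rintro q ⟨ω, rfl, x, hx, y, hy, hxy, rfl⟩
  rw [div_le_iff₀ (abs_pos.2 (sub_ne_zero.2 hxy))]
  exact abs_thetaWord_sub_le hL h hLip ω x hx y hy

theorem eps_zero : eps H θ 0 = 1 := if_pos rfl

theorem eps_nonneg (ν : ℕ) : 0 ≤ eps H θ ν := by
  unfold eps
  split_ifs
  · exact zero_le_one
  · refine Real.sSup_nonneg ?_
    rintro q ⟨ω, -, x, -, y, -, -, rfl⟩
    positivity

theorem eps_le {ν : ℕ} (hν : ν ≠ 0) {K : ℝ} (hK : 0 ≤ K)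
    (h : ∀ ω : List B, ω.length = ν → ∀ x ∈ H, ∀ y ∈ H,
      |thetaWord θ ω x - thetaWord θ ω y| ≤ K * |x - y|) : eps H θ ν ≤ K := by
  rw [eps, if_neg hν]
  refine Real.sSup_le ?_ hK
  rintro q ⟨ω, hω, x, hx, y, hy, hxy, rfl⟩
  rw [div_le_iff₀ (abs_pos.2 (sub_ne_zero.2 hxy))]
  exact h ω hω x hx y hy

/-- The properties of the system on the open set `H` from which the derivative estimates
follow. -/
structure Regular (n : WithTop ℕ∞) (H : Set ℝ) (b θ : B → ℝ → ℝ) : Prop where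
  isOpen : IsOpen H
  b_contDiffOn : ∀ β, ContDiffOn ℝ n (b β) H
  theta_contDiffOn : ∀ β, ContDiffOn ℝ n (θ β) H
  b_pos : ∀ β, ∀ x ∈ H, 0 < b β x
  mapsTo : ∀ β, MapsTo (θ β) H H
  bddAbove : ∀ ν, BddAbove (epsSet H θ ν)

namespace Regular

variable {n : WithTop ℕ∞}

theorem of_le {k : WithTop ℕ∞} (h : Regular n H b θ) (hk : k ≤ n) : Regular k H b θ :=
  { h with
    b_contDiffOn := fun β => (h.b_contDiffOn β).of_le hk
    theta_contDiffOn := fun β => (h.theta_contDiffOn β).of_le hk }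

theorem mapsTo_word (h : Regular n H b θ) (ω : List B) : MapsTo (thetaWord θ ω) H H :=
  mapsTo_thetaWord h.mapsTo ω

theorem contDiffOn_word (h : Regular n H b θ) (ω : List B) : ContDiffOn ℝ n (thetaWord θ ω) H :=
  contDiffOn_thetaWord h.theta_contDiffOn h.mapsTo ω

theorem contDiffOn_comp_word (h : Regular n H b θ) {f : ℝ → ℝ} (hf : ContDiffOn ℝ n f H)
    (ω : List B) : ContDiffOn ℝ n (fun y => f (thetaWord θ ω y)) H :=
  hf.comp (h.contDiffOn_word ω) (h.mapsTo_word ω)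

theorem contDiffOn_log (h : Regular n H b θ) (β : B) :
    ContDiffOn ℝ n (fun y => Real.log (b β y)) H :=
  (h.b_contDiffOn β).log fun x hx => (h.b_pos β x hx).ne'

theorem contDiffOn_log_word (h : Regular n H b θ) (ω : List B) :
    ContDiffOn ℝ n (fun y => Real.log (bWord b θ ω y)) H :=
  (contDiffOn_bWord h.b_contDiffOn h.theta_contDiffOn h.mapsTo ω).log
    fun x hx => (bWord_pos h.b_pos h.mapsTo ω x hx).ne'

theorem log_bWord_snoc (h : Regular n H b θ) (ω : List B) (β : B) :
    EqOn (fun y => Real.log (bWord b θ (ω ++ [β]) y))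
      (fun y => Real.log (b β (thetaWord θ ω y)) + Real.log (bWord b θ ω y)) H := fun y hy => by
  simp only [bWord_snoc]
  exact Real.log_mul (h.b_pos β _ (h.mapsTo_word ω hy)).ne'
    (bWord_pos h.b_pos h.mapsTo ω y hy).ne'

theorem abs_sub_le_eps (h : Regular n H b θ) (ω : List B) {x y : ℝ} (hx : x ∈ H) (hy : y ∈ H) :
    |thetaWord θ ω x - thetaWord θ ω y| ≤ eps H θ ω.length * |x - y| := by
  rcases eq_or_ne x y with rfl | hxy
  · simp
  rcases eq_or_ne ω.length 0 with h0 | h0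
  · rw [List.length_eq_zero_iff.1 h0]
    simp [thetaWord, eps_zero]
  rw [← div_le_iff₀ (abs_pos.2 (sub_ne_zero.2 hxy)), eps, if_neg h0]
  exact le_csSup (h.bddAbove _) ⟨ω, rfl, x, hx, y, hy, hxy, rfl⟩

/-- Cutting a word after i letters factors θ_ω, and Lipschitz constants multiply under composition.
-/
theorem eps_add_le (h : Regular n H b θ) (i j : ℕ) :
    eps H θ (i + j) ≤ eps H θ i * eps H θ j := by
  rcases Nat.eq_zero_or_pos (i + j) with h0 | h0
  · obtain ⟨rfl, rfl⟩ : i = 0 ∧ j = 0 := by omega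
    simp [eps_zero]
  refine eps_le h0.ne' (mul_nonneg (eps_nonneg i) (eps_nonneg j)) fun ω hω x hx y hy => ?_
  have hi : (ω.take i).length = i := by simp [hω]
  have hj : (ω.drop i).length = j := by simp [hω]
  rw [← List.take_append_drop i ω, thetaWord_append, thetaWord_append]
  calc _ ≤ eps H θ j * |thetaWord θ (ω.take i) x - thetaWord θ (ω.take i) y| := by
        simpa only [hj] using h.abs_sub_le_eps (ω.drop i) (h.mapsTo_word _ hx) (h.mapsTo_word _ hy)
    _ ≤ eps H θ j * (eps H θ i * |x - y|) := by
        refine mul_le_mul_of_nonneg_left ?_ (eps_nonneg j)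
        simpa only [hi] using h.abs_sub_le_eps (ω.take i) hx hy
    _ = _ := by ring

theorem abs_deriv_word_le (h : Regular n H b θ) (ω : List B) {x : ℝ} (hx : x ∈ H) :
    |deriv (thetaWord θ ω) x| ≤ eps H θ ω.length := by
  rw [← Real.norm_eq_abs]
  refine norm_deriv_le_of_lip' (eps_nonneg _) ?_
  filter_upwards [h.isOpen.mem_nhds hx] with y hy
  exact h.abs_sub_le_eps ω hy hx

theorem deriv_word_sq_le (h : Regular n H b θ) (ω : List B) {x : ℝ} (hx : x ∈ H) :
    deriv (thetaWord θ ω) x ^ 2 ≤ eps H θ ω.length ^ 2 :=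
  sq_le_sq' (neg_le_of_abs_le (h.abs_deriv_word_le ω hx)) (le_of_abs_le (h.abs_deriv_word_le ω hx))

end Regular

/-- The convolution of `ε²` and `ε`, shifted by one; up to the factor `M₀` it bounds the second
derivatives of the maps `θ_ω`, `ω` of length `ν`. -/
def epsConv (H : Set ℝ) (θ : B → ℝ → ℝ) (ν : ℕ) : ℝ :=
  ∑ i ∈ Finset.range ν, eps H θ i ^ 2 * eps H θ (ν - 1 - i)

theorem epsConv_nonneg (ν : ℕ) : 0 ≤ epsConv H θ ν :=
  Finset.sum_nonneg fun _ _ => mul_nonneg (sq_nonneg _) (eps_nonneg _)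

theorem hasSum_epsConv (h1 : Summable fun k => eps H θ k) (h2 : Summable fun k => eps H θ k ^ 2) :
    HasSum (epsConv H θ) ((∑' k, eps H θ k ^ 2) * ∑' k, eps H θ k) := by
  have h := hasSum_sum_range_mul_of_summable_norm h2.norm h1.norm
  -- The Cauchy product coefficient at ν is `epsConv` at ν + 1; the missing term at 0 is an empty
  -- sum.
  have h' := (hasSum_nat_add_iff (f := epsConv H θ) 1).1 (by simpa [epsConv] using h)
  simpa [epsConv] using h'

theorem sum_range_le_tsum_epsConv {C₁ C₂ M : ℝ} (hsum : Summable fun k => eps H θ k)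
    (hsum2 : Summable fun k => eps H θ k ^ 2) (hC₁ : 0 ≤ C₁) (hC₂ : 0 ≤ C₂) (hM : 0 ≤ M) (ν : ℕ) :
    ∑ k ∈ Finset.range ν, (C₂ * eps H θ k ^ 2 + C₁ * (M * epsConv H θ k)) ≤
      (∑' k, eps H θ k ^ 2) * (C₂ + C₁ * M * ∑' k, eps H θ k) := by
  have h1 := (hsum2.hasSum.mul_left C₂).add
    (((hasSum_epsConv hsum hsum2).mul_left M).mul_left C₁)
  refine (sum_le_hasSum _ (fun k _ => ?_) h1).trans_eq (by ring)
  exact add_nonneg (mul_nonneg hC₂ (sq_nonneg _))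
    (mul_nonneg hC₁ (mul_nonneg hM (epsConv_nonneg k)))

namespace Regular

/-- Each letter contributes (tail)' · θ_β'' · (prefix')². The prefix p is carried through the
induction so that its derivative is estimated as that of one word, by ε at its length; estimating
letter by letter would only give powers of ε_1. -/
theorem abs_deriv_deriv_word_mul_le (h : Regular 2 H b θ) {M : ℝ}
    (hM : ∀ β, ∀ x ∈ H, |deriv (deriv (θ β)) x| ≤ M) (p q : List B) {x : ℝ} (hx : x ∈ H) :
    |deriv (deriv (thetaWord θ q)) (thetaWord θ p x)| * deriv (thetaWord θ p) x ^ 2 ≤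
      M * ∑ i ∈ Finset.range q.length,
        eps H θ (p.length + i) ^ 2 * eps H θ (q.length - 1 - i) := by
  induction q generalizing p with
  | nil =>
    have : deriv (thetaWord θ ([] : List B)) = fun _ => 1 := by
      funext y
      exact deriv_id y
    simp [this]
  | cons β q ih =>
    have h1 := h.of_le one_le_two
    have hp := h.mapsTo_word p hx
    have hM0 : 0 ≤ M := (abs_nonneg _).trans (hM β x hx)
    have hcomp : deriv (deriv (thetaWord θ (β :: q))) (thetaWord θ p x) = _ :=
      deriv_deriv_comp_of_mapsTo (g := θ β) h.isOpen (h.contDiffOn_word q) (h.theta_contDiffOn β)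
        (h.mapsTo β) hp
    have hsnoc : deriv (thetaWord θ (p ++ [β])) x =
        deriv (θ β) (thetaWord θ p x) * deriv (thetaWord θ p) x := by
      rw [show thetaWord θ (p ++ [β]) = fun y => θ β (thetaWord θ p y) from
        funext fun y => thetaWord_append p [β] y]
      exact deriv_comp_of_mapsTo h.isOpen (h1.theta_contDiffOn β) (h1.contDiffOn_word p)
        (h.mapsTo_word p) hx
    have ih' := ih (p ++ [β])
    rw [hsnoc, show thetaWord θ (p ++ [β]) x = θ β (thetaWord θ p x) from
      thetaWord_append p [β] x] at ih'
    have e2 : |deriv (thetaWord θ q) (θ β (thetaWord θ p x)) *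
        deriv (deriv (θ β)) (thetaWord θ p x)| * deriv (thetaWord θ p) x ^ 2 ≤
        M * (eps H θ p.length ^ 2 * eps H θ q.length) := by
      rw [abs_mul]
      calc _ ≤ eps H θ q.length * M * eps H θ p.length ^ 2 := by
            refine mul_le_mul (mul_le_mul (h.abs_deriv_word_le q (h.mapsTo β hp)) (hM β _ hp)
              (abs_nonneg _) (eps_nonneg _)) (h.deriv_word_sq_le p hx) (sq_nonneg _)
              (mul_nonneg (eps_nonneg _) hM0)
        _ = _ := by ring
    -- The term i = 0 is the contribution of β itself, bounded by `e2`; the others come from the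
    -- induction hypothesis with prefix p ++ [β].
    rw [hcomp, List.length_cons, Finset.sum_range_succ', mul_add]
    calc _ ≤ (|deriv (deriv (thetaWord θ q)) (θ β (thetaWord θ p x))| *
            deriv (θ β) (thetaWord θ p x) ^ 2 +
            |deriv (thetaWord θ q) (θ β (thetaWord θ p x)) *
              deriv (deriv (θ β)) (thetaWord θ p x)|) * deriv (thetaWord θ p) x ^ 2 := by
          gcongr
          refine (abs_add_le _ _).trans_eq ?_
          rw [abs_mul (deriv (deriv (thetaWord θ q)) _), abs_sq]
      _ = |deriv (deriv (thetaWord θ q)) (θ β (thetaWord θ p x))| *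
            (deriv (θ β) (thetaWord θ p x) * deriv (thetaWord θ p) x) ^ 2 +
            |deriv (thetaWord θ q) (θ β (thetaWord θ p x)) *
              deriv (deriv (θ β)) (thetaWord θ p x)| * deriv (thetaWord θ p) x ^ 2 := by ring
      _ ≤ _ := by
          refine add_le_add (ih'.trans_eq ?_) (e2.trans_eq (by simp))
          congr 1
          refine Finset.sum_congr rfl fun i hi => ?_
          have hi := Finset.mem_range.1 hi
          rw [show (p ++ [β]).length + i = p.length + (i + 1) by
              rw [List.length_append, List.length_singleton]; omega,
            show q.length - 1 - i = q.length + 1 - 1 - (i + 1) by omega]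

theorem abs_deriv_deriv_word_le (h : Regular 2 H b θ) {M : ℝ}
    (hM : ∀ β, ∀ x ∈ H, |deriv (deriv (θ β)) x| ≤ M) (ω : List B) {x : ℝ} (hx : x ∈ H) :
    |deriv (deriv (thetaWord θ ω)) x| ≤ M * epsConv H θ ω.length := by
  have h1 : deriv (thetaWord θ ([] : List B)) x = 1 := deriv_id x
  have := h.abs_deriv_deriv_word_mul_le hM [] ω hx
  rw [h1, one_pow, mul_one] at this
  simpa [epsConv, thetaWord] using this

/-- The first derivative of a composition with `θ_ω`. -/
theorem abs_deriv_comp_word_le (h : Regular 1 H b θ) {f : ℝ → ℝ} (hf : ContDiffOn ℝ 1 f H)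
    {K : ℝ} (hK : ∀ x ∈ H, |deriv f x| ≤ K) (ω : List B) {x : ℝ} (hx : x ∈ H) :
    |deriv (fun y => f (thetaWord θ ω y)) x| ≤ K * eps H θ ω.length := by
  rw [deriv_comp_of_mapsTo h.isOpen hf (h.contDiffOn_word ω) (h.mapsTo_word ω) hx, abs_mul]
  exact mul_le_mul (hK _ (h.mapsTo_word ω hx)) (h.abs_deriv_word_le ω hx) (abs_nonneg _)
    ((abs_nonneg _).trans (hK x hx))

/-- Upper bound for the second derivative of a composition with `θ_ω`. -/
theorem deriv_deriv_comp_word_le (h : Regular 2 H b θ) {M : ℝ}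
    (hM : ∀ β, ∀ x ∈ H, |deriv (deriv (θ β)) x| ≤ M) {f : ℝ → ℝ} (hf : ContDiffOn ℝ 2 f H)
    {K K' : ℝ} (hK : ∀ x ∈ H, |deriv f x| ≤ K) (hK0 : 0 ≤ K')
    (hK' : ∀ x ∈ H, deriv (deriv f) x ≤ K') (ω : List B) {x : ℝ} (hx : x ∈ H) :
    deriv (deriv fun y => f (thetaWord θ ω y)) x ≤
      K' * eps H θ ω.length ^ 2 + K * (M * epsConv H θ ω.length) := by
  have hω := h.mapsTo_word ω hx
  rw [deriv_deriv_comp_of_mapsTo h.isOpen hf (h.contDiffOn_word ω) (h.mapsTo_word ω) hx]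
  refine add_le_add ?_ ?_
  · exact mul_le_mul (hK' _ hω) (h.deriv_word_sq_le ω hx) (sq_nonneg _) hK0
  · refine (le_abs_self _).trans ?_
    rw [abs_mul]
    exact mul_le_mul (hK _ hω) (h.abs_deriv_deriv_word_le hM ω hx) (abs_nonneg _)
      ((abs_nonneg _).trans (hK x hx))

/-- Lower bound for the second derivative of a composition with `θ_ω`. -/
theorem le_deriv_deriv_comp_word (h : Regular 2 H b θ) {M : ℝ}
    (hM : ∀ β, ∀ x ∈ H, |deriv (deriv (θ β)) x| ≤ M) {f : ℝ → ℝ} (hf : ContDiffOn ℝ 2 f H)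
    {K K' : ℝ} (hK : ∀ x ∈ H, |deriv f x| ≤ K) (hK0 : 0 ≤ K')
    (hK' : ∀ x ∈ H, -K' ≤ deriv (deriv f) x) (ω : List B) {x : ℝ} (hx : x ∈ H) :
    -(K' * eps H θ ω.length ^ 2 + K * (M * epsConv H θ ω.length)) ≤
      deriv (deriv fun y => f (thetaWord θ ω y)) x := by
  have := h.deriv_deriv_comp_word_le hM (f := fun y => -f y) hf.neg (K := K) (K' := K')
    (by simpa using hK) hK0 (by simpa using fun x hx => neg_le.1 (hK' x hx)) ω hx
  simp only [deriv.fun_neg'] at this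
  linarith

/-- The logarithm turns the product into a sum, in which the letter preceded by k others contributes
at most C₁ ε_k. -/
theorem abs_deriv_log_bWord_le (h : Regular 1 H b θ) {C₁ : ℝ}
    (h1 : ∀ β, ∀ x ∈ H, |deriv (fun y => Real.log (b β y)) x| ≤ C₁) (ω : List B) {x : ℝ}
    (hx : x ∈ H) :
    |deriv (fun y => Real.log (bWord b θ ω y)) x| ≤
      C₁ * ∑ k ∈ Finset.range ω.length, eps H θ k := by
  induction ω using List.reverseRecOn with
  | nil => simp [bWord]
  | append_singleton ω β ih =>
    rw [(h.log_bWord_snoc ω β).deriv h.isOpen hx, deriv_add_of_contDiffOn h.isOpen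
      (h.contDiffOn_comp_word (h.contDiffOn_log β) ω)
      (h.contDiffOn_log_word ω) hx, List.length_append, List.length_singleton,
      Finset.sum_range_succ, mul_add, add_comm]
    refine (abs_add_le _ _).trans (add_le_add ih ?_)
    exact h.abs_deriv_comp_word_le (h.contDiffOn_log β) (h1 β) ω hx

theorem deriv_deriv_log_bWord_le (h : Regular 2 H b θ) {C₁ C₂ M : ℝ}
    (hM : ∀ β, ∀ x ∈ H, |deriv (deriv (θ β)) x| ≤ M)
    (h1 : ∀ β, ∀ x ∈ H, |deriv (fun y => Real.log (b β y)) x| ≤ C₁) (h0 : 0 ≤ C₂)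
    (h2 : ∀ β, ∀ x ∈ H, deriv (deriv fun y => Real.log (b β y)) x ≤ C₂) (ω : List B) {x : ℝ}
    (hx : x ∈ H) :
    deriv (deriv fun y => Real.log (bWord b θ ω y)) x ≤
      ∑ k ∈ Finset.range ω.length, (C₂ * eps H θ k ^ 2 + C₁ * (M * epsConv H θ k)) := by
  induction ω using List.reverseRecOn with
  | nil => simp [bWord]
  | append_singleton ω β ih =>
    rw [((h.log_bWord_snoc ω β).deriv h.isOpen).deriv h.isOpen hx,
      deriv_deriv_add_of_contDiffOn h.isOpen
      (h.contDiffOn_comp_word (h.contDiffOn_log β) ω)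
      (h.contDiffOn_log_word ω) hx, List.length_append, List.length_singleton,
      Finset.sum_range_succ, add_comm]
    exact add_le_add ih (h.deriv_deriv_comp_word_le hM (h.contDiffOn_log β) (h1 β) h0 (h2 β) ω hx)

theorem le_deriv_deriv_log_bWord (h : Regular 2 H b θ) {C₁ C₂ M : ℝ}
    (hM : ∀ β, ∀ x ∈ H, |deriv (deriv (θ β)) x| ≤ M)
    (h1 : ∀ β, ∀ x ∈ H, |deriv (fun y => Real.log (b β y)) x| ≤ C₁) (h0 : 0 ≤ C₂)
    (h2 : ∀ β, ∀ x ∈ H, -C₂ ≤ deriv (deriv fun y => Real.log (b β y)) x) (ω : List B) {x : ℝ}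
    (hx : x ∈ H) :
    -∑ k ∈ Finset.range ω.length, (C₂ * eps H θ k ^ 2 + C₁ * (M * epsConv H θ k)) ≤
      deriv (deriv fun y => Real.log (bWord b θ ω y)) x := by
  induction ω using List.reverseRecOn with
  | nil => simp [bWord]
  | append_singleton ω β ih =>
    rw [((h.log_bWord_snoc ω β).deriv h.isOpen).deriv h.isOpen hx,
      deriv_deriv_add_of_contDiffOn h.isOpen
      (h.contDiffOn_comp_word (h.contDiffOn_log β) ω)
      (h.contDiffOn_log_word ω) hx, List.length_append, List.length_singleton,
      Finset.sum_range_succ, add_comm (deriv _ x), neg_add]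
    exact add_le_add ih (h.le_deriv_deriv_comp_word hM (h.contDiffOn_log β) (h1 β) h0 (h2 β) ω hx)

end Regular

end Words

/-! ### The eigenvector as a sum of exponentials, and the limit of long words. -/

section Eigenvector

variable {B : Type*} [Fintype B] {H : Set ℝ} {b θ : B → ℝ → ℝ} {s r : ℝ} {v : ℝ → ℝ}

/-- A strictly positive eigenvector, on the open set `H`, of the transfer operator of a regular
system. -/
structure PosEigen (n : WithTop ℕ∞) (H : Set ℝ) (b θ : B → ℝ → ℝ) (s r : ℝ) (v : ℝ → ℝ) : Prop
    extends Regular n H b θ where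
  s_pos : 0 < s
  r_pos : 0 < r
  v_contDiffOn : ContDiffOn ℝ n v H
  v_pos : ∀ x ∈ H, 0 < v x
  eigen : ∀ x ∈ H, transferOp b θ s v x = r * v x

/-- The logarithm of the summand of `L_s^ν v` that belongs to the word `ω`. -/
def logSummand (b θ : B → ℝ → ℝ) (s : ℝ) (v : ℝ → ℝ) (ω : List B) (y : ℝ) : ℝ :=
  s * Real.log (bWord b θ ω y) + Real.log (v (thetaWord θ ω y))

namespace PosEigen

variable {n : WithTop ℕ∞}

theorem of_le {k : WithTop ℕ∞} (h : PosEigen n H b θ s r v) (hk : k ≤ n) :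
    PosEigen k H b θ s r v :=
  { h with
    toRegular := h.toRegular.of_le hk
    v_contDiffOn := h.v_contDiffOn.of_le hk }

/-- The eigenvalue equation at x is followed by the induction hypothesis at θ_β x, so letters are
prepended. Later arguments use only the length of the words in W. -/
theorem pow_mul_eq_sum (h : PosEigen n H b θ s r v) (ν : ℕ) :
    ∃ W : Finset (List B), (∀ ω ∈ W, ω.length = ν) ∧ ∀ x ∈ H,
      r ^ ν * v x = ∑ ω ∈ W, bWord b θ ω x ^ s * v (thetaWord θ ω x) := by
  induction ν with
  | zero => exact ⟨{[]}, by simp, by simp [bWord, thetaWord]⟩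
  | succ ν ih =>
    obtain ⟨W, hW, hsum⟩ := ih
    have hinj : Function.Injective fun p : B × List B => p.1 :: p.2 := fun p q hpq => by
      obtain ⟨h1, h2⟩ := List.cons.inj hpq
      exact Prod.ext h1 h2
    refine ⟨(Finset.univ ×ˢ W).map ⟨_, hinj⟩, fun ω hω => ?_, fun x hx => ?_⟩
    · obtain ⟨p, hp, rfl⟩ := Finset.mem_map.1 hω
      simp [hW _ (Finset.mem_product.1 hp).2]
    · rw [Finset.sum_map, Finset.sum_product, pow_succ, mul_assoc, ← h.eigen x hx, transferOp,
        Finset.mul_sum]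
      refine Finset.sum_congr rfl fun β _ => ?_
      rw [mul_left_comm, hsum _ (h.mapsTo β hx), Finset.mul_sum]
      refine Finset.sum_congr rfl fun ω _ => ?_
      simp only [Function.Embedding.coeFn_mk, bWord, thetaWord]
      rw [Real.mul_rpow (bWord_pos h.b_pos h.mapsTo ω _ (h.mapsTo β hx)).le (h.b_pos β x hx).le]
      ring

theorem pow_mul_eq_sum_exp (h : PosEigen n H b θ s r v) (ν : ℕ) :
    ∃ W : Finset (List B), (∀ ω ∈ W, ω.length = ν) ∧ ∀ x ∈ H,
      r ^ ν * v x = ∑ ω ∈ W, Real.exp (logSummand b θ s v ω x) := by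
  obtain ⟨W, hW, hsum⟩ := h.pow_mul_eq_sum ν
  refine ⟨W, hW, fun x hx => (hsum x hx).trans (Finset.sum_congr rfl fun ω _ => ?_)⟩
  rw [logSummand, Real.exp_add, Real.exp_log (h.v_pos _ (h.mapsTo_word ω hx)),
    Real.rpow_def_of_pos (bWord_pos h.b_pos h.mapsTo ω x hx), mul_comm s]

theorem contDiffOn_log_v (h : PosEigen n H b θ s r v) :
    ContDiffOn ℝ n (fun y => Real.log (v y)) H :=
  h.v_contDiffOn.log fun x hx => (h.v_pos x hx).ne'

theorem contDiffOn_logSummand (h : PosEigen n H b θ s r v) (ω : List B) :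
    ContDiffOn ℝ n (logSummand b θ s v ω) H :=
  (contDiffOn_const.mul (h.contDiffOn_log_word ω)).add (h.contDiffOn_comp_word h.contDiffOn_log_v ω)

theorem deriv_logSummand (h : PosEigen 1 H b θ s r v) (ω : List B) {x : ℝ} (hx : x ∈ H) :
    deriv (logSummand b θ s v ω) x = s * deriv (fun y => Real.log (bWord b θ ω y)) x +
      deriv (fun y => Real.log (v (thetaWord θ ω y))) x := by
  rw [← deriv_const_mul_field]
  exact deriv_add_of_contDiffOn h.isOpen (contDiffOn_const.mul (h.contDiffOn_log_word ω))
    (h.contDiffOn_comp_word h.contDiffOn_log_v ω) hx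

theorem deriv_deriv_logSummand (h : PosEigen 2 H b θ s r v) (ω : List B) {x : ℝ} (hx : x ∈ H) :
    deriv (deriv (logSummand b θ s v ω)) x =
      s * deriv (deriv fun y => Real.log (bWord b θ ω y)) x +
      deriv (deriv fun y => Real.log (v (thetaWord θ ω y))) x := by
  have := deriv_deriv_add_of_contDiffOn h.isOpen
    (contDiffOn_const (c := s).mul (h.contDiffOn_log_word ω))
    (h.contDiffOn_comp_word h.contDiffOn_log_v ω) hx
  refine this.trans ?_
  have e : deriv (fun y => s * Real.log (bWord b θ ω y)) =
      fun y => s * deriv (fun y => Real.log (bWord b θ ω y)) y :=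
    funext fun y => deriv_const_mul_field s
  rw [e, deriv_const_mul_field]

/-- An upper bound for the derivatives of all summands bounds the logarithmic derivative of the
eigenvector. -/
theorem deriv_le_mul (h : PosEigen 1 H b θ s r v) (ν : ℕ) {x k : ℝ} (hx : x ∈ H)
    (hk : ∀ ω : List B, ω.length = ν → deriv (logSummand b θ s v ω) x ≤ k) :
    deriv v x ≤ k * v x := by
  obtain ⟨W, hW, hsum⟩ := h.pow_mul_eq_sum_exp ν
  exact le_mul_of_weighted_sum (pow_pos h.r_pos ν) (fun ω _ => (Real.exp_pos _).le)
    (mul_deriv_eq_sum_exp h.isOpen (fun ω _ => h.contDiffOn_logSummand ω) h.v_contDiffOn hsum hx)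
    (hsum x hx) fun ω hω => hk ω (hW ω hω)

theorem mul_le_deriv (h : PosEigen 1 H b θ s r v) (ν : ℕ) {x k : ℝ} (hx : x ∈ H)
    (hk : ∀ ω : List B, ω.length = ν → k ≤ deriv (logSummand b θ s v ω) x) :
    k * v x ≤ deriv v x := by
  obtain ⟨W, hW, hsum⟩ := h.pow_mul_eq_sum_exp ν
  exact mul_le_of_weighted_sum (pow_pos h.r_pos ν) (fun ω _ => (Real.exp_pos _).le)
    (mul_deriv_eq_sum_exp h.isOpen (fun ω _ => h.contDiffOn_logSummand ω) h.v_contDiffOn hsum hx)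
    (hsum x hx) fun ω hω => hk ω (hW ω hω)

theorem deriv_deriv_le_mul (h : PosEigen 2 H b θ s r v) (ν : ℕ) {x k : ℝ} (hx : x ∈ H)
    (hk : ∀ ω : List B, ω.length = ν →
      deriv (deriv (logSummand b θ s v ω)) x + deriv (logSummand b θ s v ω) x ^ 2 ≤ k) :
    deriv (deriv v) x ≤ k * v x := by
  obtain ⟨W, hW, hsum⟩ := h.pow_mul_eq_sum_exp ν
  exact le_mul_of_weighted_sum (pow_pos h.r_pos ν) (fun ω _ => (Real.exp_pos _).le)
    (mul_deriv_deriv_eq_sum_exp h.isOpen (fun ω _ => h.contDiffOn_logSummand ω) h.v_contDiffOn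
      hsum hx) (hsum x hx) fun ω hω => hk ω (hW ω hω)

/-- The square of the first derivative of the exponent is nonnegative and is simply dropped. -/
theorem mul_le_deriv_deriv (h : PosEigen 2 H b θ s r v) (ν : ℕ) {x k : ℝ} (hx : x ∈ H)
    (hk : ∀ ω : List B, ω.length = ν → k ≤ deriv (deriv (logSummand b θ s v ω)) x) :
    k * v x ≤ deriv (deriv v) x := by
  obtain ⟨W, hW, hsum⟩ := h.pow_mul_eq_sum_exp ν
  exact mul_le_of_weighted_sum (pow_pos h.r_pos ν) (fun ω _ => (Real.exp_pos _).le)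
    (mul_deriv_deriv_eq_sum_exp h.isOpen (fun ω _ => h.contDiffOn_logSummand ω) h.v_contDiffOn
      hsum hx) (hsum x hx) fun ω hω => (hk ω (hW ω hω)).trans (le_add_of_nonneg_right (sq_nonneg _))

theorem abs_deriv_logSummand_le (h : PosEigen 1 H b θ s r v) {C₁ K : ℝ}
    (hsum : Summable fun k => eps H θ k) (hC₁ : 0 ≤ C₁)
    (h1 : ∀ β, ∀ x ∈ H, |deriv (fun y => Real.log (b β y)) x| ≤ C₁)
    (hK : ∀ x ∈ H, |deriv (fun y => Real.log (v y)) x| ≤ K) (ω : List B) {x : ℝ} (hx : x ∈ H) :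
    |deriv (logSummand b θ s v ω) x| ≤
      s * (C₁ * ∑' k, eps H θ k) + K * eps H θ ω.length := by
  rw [h.deriv_logSummand ω hx]
  refine (abs_add_le _ _).trans (add_le_add ?_ ?_)
  · rw [abs_mul, abs_of_pos h.s_pos]
    refine mul_le_mul_of_nonneg_left ((h.abs_deriv_log_bWord_le h1 ω hx).trans ?_) h.s_pos.le
    exact mul_le_mul_of_nonneg_left (hsum.sum_le_tsum _ fun k _ => eps_nonneg k) hC₁
  · exact h.abs_deriv_comp_word_le h.contDiffOn_log_v hK ω hx

theorem abs_deriv_le (h : PosEigen 1 H b θ s r v) {C₁ K : ℝ}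
    (hsum : Summable fun k => eps H θ k) (hC₁ : 0 ≤ C₁)
    (h1 : ∀ β, ∀ x ∈ H, |deriv (fun y => Real.log (b β y)) x| ≤ C₁)
    (hK : ∀ x ∈ H, |deriv (fun y => Real.log (v y)) x| ≤ K) {x : ℝ} (hx : x ∈ H) :
    |deriv v x| ≤ s * (C₁ * ∑' k, eps H θ k) * v x := by
  have hlim : Tendsto (fun ν => (s * (C₁ * ∑' k, eps H θ k) + K * eps H θ ν) * v x) atTop
      (𝓝 ((s * (C₁ * ∑' k, eps H θ k) + K * 0) * v x)) :=
    ((hsum.tendsto_atTop_zero.const_mul K).const_add _).mul_const _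
  rw [mul_zero, add_zero] at hlim
  -- The bound K on the derivative of log v enters only through K ε_ν, which vanishes in the limit.
  refine ge_of_tendsto' hlim fun ν => abs_le.2 ⟨?_, ?_⟩
  · rw [← neg_mul]
    refine h.mul_le_deriv ν hx fun ω hω => ?_
    rw [← hω]
    exact neg_le_of_abs_le (h.abs_deriv_logSummand_le hsum hC₁ h1 hK ω hx)
  · refine h.deriv_le_mul ν hx fun ω hω => ?_
    rw [← hω]
    exact le_of_abs_le (h.abs_deriv_logSummand_le hsum hC₁ h1 hK ω hx)

theorem deriv_nonpos (h : PosEigen 1 H b θ s r v) {K : ℝ} (hsum : Summable fun k => eps H θ k)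
    (hK : ∀ x ∈ H, |deriv (fun y => Real.log (v y)) x| ≤ K) {x : ℝ} (hx : x ∈ H)
    (hb : ∀ ω : List B, 1 ≤ ω.length → deriv (fun y => Real.log (bWord b θ ω y)) x ≤ 0) :
    deriv v x ≤ 0 := by
  -- Lengths start at 1, since the sign is assumed only for nonempty words.
  have hlim : Tendsto (fun ν => K * eps H θ (ν + 1) * v x) atTop (𝓝 (K * 0 * v x)) :=
    (((tendsto_add_atTop_iff_nat 1).2 hsum.tendsto_atTop_zero).const_mul K).mul_const _
  rw [mul_zero, zero_mul] at hlim
  refine ge_of_tendsto' hlim fun ν => h.deriv_le_mul (ν + 1) hx fun ω hω => ?_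
  rw [h.deriv_logSummand ω hx, ← hω]
  have h1 := le_of_abs_le (h.abs_deriv_comp_word_le h.contDiffOn_log_v hK ω hx)
  have h2 := mul_nonpos_of_nonneg_of_nonpos h.s_pos.le (hb ω (by omega))
  linarith

theorem deriv_nonneg (h : PosEigen 1 H b θ s r v) {K : ℝ} (hsum : Summable fun k => eps H θ k)
    (hK : ∀ x ∈ H, |deriv (fun y => Real.log (v y)) x| ≤ K) {x : ℝ} (hx : x ∈ H)
    (hb : ∀ ω : List B, 1 ≤ ω.length → 0 ≤ deriv (fun y => Real.log (bWord b θ ω y)) x) :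
    0 ≤ deriv v x := by
  have hlim : Tendsto (fun ν => -(K * eps H θ (ν + 1)) * v x) atTop (𝓝 (-(K * 0) * v x)) :=
    (((tendsto_add_atTop_iff_nat 1).2 hsum.tendsto_atTop_zero).const_mul K).neg.mul_const _
  rw [mul_zero, neg_zero, zero_mul] at hlim
  refine le_of_tendsto' hlim fun ν => h.mul_le_deriv (ν + 1) hx fun ω hω => ?_
  rw [h.deriv_logSummand ω hx, ← hω]
  have h1 := neg_le_of_abs_le (h.abs_deriv_comp_word_le h.contDiffOn_log_v hK ω hx)
  have h2 := mul_nonneg h.s_pos.le (hb ω (by omega))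
  linarith

theorem deriv_deriv_le (h : PosEigen 2 H b θ s r v) {C₁ C₂ M K K' : ℝ}
    (hsum : Summable fun k => eps H θ k) (hsum2 : Summable fun k => eps H θ k ^ 2)
    (hC₁ : 0 ≤ C₁) (hC₂ : 0 ≤ C₂) (hM0 : 0 ≤ M) (hK0 : 0 ≤ K')
    (hM : ∀ β, ∀ x ∈ H, |deriv (deriv (θ β)) x| ≤ M)
    (h1 : ∀ β, ∀ x ∈ H, |deriv (fun y => Real.log (b β y)) x| ≤ C₁)
    (h2 : ∀ β, ∀ x ∈ H, deriv (deriv fun y => Real.log (b β y)) x ≤ C₂)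
    (hK : ∀ x ∈ H, |deriv (fun y => Real.log (v y)) x| ≤ K)
    (hK' : ∀ x ∈ H, deriv (deriv fun y => Real.log (v y)) x ≤ K') {x : ℝ} (hx : x ∈ H) :
    deriv (deriv v) x ≤
      (s * ((∑' k, eps H θ k ^ 2) * (C₂ + C₁ * M * ∑' k, eps H θ k)) +
        (s * (C₁ * ∑' k, eps H θ k)) ^ 2) * v x := by
  have h' := h.of_le one_le_two
  have hlim : Tendsto (fun ν =>
      (s * ((∑' k, eps H θ k ^ 2) * (C₂ + C₁ * M * ∑' k, eps H θ k)) +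
        (K' * eps H θ ν ^ 2 + K * (M * epsConv H θ ν)) +
        (s * (C₁ * ∑' k, eps H θ k) + K * eps H θ ν) ^ 2) * v x) atTop
      (𝓝 ((s * ((∑' k, eps H θ k ^ 2) * (C₂ + C₁ * M * ∑' k, eps H θ k)) +
        (K' * 0 + K * (M * 0)) + (s * (C₁ * ∑' k, eps H θ k) + K * 0) ^ 2) * v x)) :=
    ((((hsum2.tendsto_atTop_zero.const_mul K').add
      (((hasSum_epsConv hsum hsum2).summable.tendsto_atTop_zero.const_mul M).const_mul K)).const_add
      _).add (((hsum.tendsto_atTop_zero.const_mul K).const_add _).pow 2)).mul_const _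
  simp only [mul_zero, add_zero] at hlim
  refine ge_of_tendsto' hlim fun ν => h.deriv_deriv_le_mul ν hx fun ω hω => ?_
  have e1 := h'.abs_deriv_logSummand_le hsum hC₁ h1 hK ω hx
  rw [h.deriv_deriv_logSummand ω hx, ← hω]
  refine add_le_add (add_le_add ?_ ?_) (sq_le_sq' (neg_le_of_abs_le e1) (le_of_abs_le e1))
  · exact mul_le_mul_of_nonneg_left ((h.deriv_deriv_log_bWord_le hM h1 hC₂ h2 ω hx).trans
      (sum_range_le_tsum_epsConv hsum hsum2 hC₁ hC₂ hM0 _)) h.s_pos.le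
  · exact h.deriv_deriv_comp_word_le hM h.contDiffOn_log_v hK hK0 hK' ω hx

theorem le_deriv_deriv (h : PosEigen 2 H b θ s r v) {C₁ C₂ M K K' : ℝ}
    (hsum : Summable fun k => eps H θ k) (hsum2 : Summable fun k => eps H θ k ^ 2)
    (hC₁ : 0 ≤ C₁) (hC₂ : 0 ≤ C₂) (hM0 : 0 ≤ M) (hK0 : 0 ≤ K')
    (hM : ∀ β, ∀ x ∈ H, |deriv (deriv (θ β)) x| ≤ M)
    (h1 : ∀ β, ∀ x ∈ H, |deriv (fun y => Real.log (b β y)) x| ≤ C₁)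
    (h2 : ∀ β, ∀ x ∈ H, -C₂ ≤ deriv (deriv fun y => Real.log (b β y)) x)
    (hK : ∀ x ∈ H, |deriv (fun y => Real.log (v y)) x| ≤ K)
    (hK' : ∀ x ∈ H, -K' ≤ deriv (deriv fun y => Real.log (v y)) x) {x : ℝ} (hx : x ∈ H) :
    -(s * ((∑' k, eps H θ k ^ 2) * (C₂ + C₁ * M * ∑' k, eps H θ k))) * v x ≤
      deriv (deriv v) x := by
  have hlim : Tendsto (fun ν =>
      (-(s * ((∑' k, eps H θ k ^ 2) * (C₂ + C₁ * M * ∑' k, eps H θ k))) +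
        -(K' * eps H θ ν ^ 2 + K * (M * epsConv H θ ν))) * v x) atTop
      (𝓝 ((-(s * ((∑' k, eps H θ k ^ 2) * (C₂ + C₁ * M * ∑' k, eps H θ k))) +
        -(K' * 0 + K * (M * 0))) * v x)) :=
    (((hsum2.tendsto_atTop_zero.const_mul K').add
      (((hasSum_epsConv hsum hsum2).summable.tendsto_atTop_zero.const_mul M).const_mul
        K)).neg.const_add _).mul_const _
  simp only [mul_zero, add_zero, neg_zero] at hlim
  refine le_of_tendsto' hlim fun ν => h.mul_le_deriv_deriv ν hx fun ω hω => ?_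
  rw [h.deriv_deriv_logSummand ω hx, ← hω]
  refine add_le_add ?_ ?_
  · rw [← mul_neg]
    exact mul_le_mul_of_nonneg_left ((neg_le_neg
      (sum_range_le_tsum_epsConv hsum hsum2 hC₁ hC₂ hM0 _)).trans
      (h.le_deriv_deriv_log_bWord hM h1 hC₂ h2 ω hx)) h.s_pos.le
  · exact h.le_deriv_deriv_comp_word hM h.contDiffOn_log_v hK hK0 hK' ω hx

end PosEigen

end Eigenvector

/-! ### Uniform bounds and Lipschitz constants on a union of separated intervals. -/

section Intervals

variable {B : Type*} [Fintype B] {H : Set ℝ}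

theorem exists_abs_le_of_forall_continuousOn (hc : IsCompact (closure H)) {F : B → ℝ → ℝ}
    (hF : ∀ β, ContinuousOn (F β) (closure H)) :
    ∃ K, 0 ≤ K ∧ ∀ β, ∀ x ∈ closure H, |F β x| ≤ K := by
  choose K hK0 hK using fun β => exists_abs_le_of_continuousOn hc (hF β)
  exact ⟨∑ β, K β, Finset.sum_nonneg fun β _ => hK0 β, fun β x hx =>
    (hK β x hx).trans (Finset.single_le_sum (fun β _ => hK0 β) (Finset.mem_univ β))⟩

/-- A bounded function with bounded derivative is Lipschitz on a finite union of open intervals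
whose closures are pairwise disjoint. -/
theorem exists_lipschitz_of_iUnion_Ioo {n : ℕ} {c d : Fin n → ℝ} (hcd : ∀ j, c j < d j)
    (hdisj : ∀ j k, j ≠ k → Disjoint (Set.Icc (c j) (d j)) (Set.Icc (c k) (d k)))
    (hH : H = ⋃ j, Set.Ioo (c j) (d j)) {f : ℝ → ℝ} (hf : ContDiffOn ℝ 1 f H) {M K : ℝ}
    (hM : ∀ x ∈ H, |f x| ≤ M) (hK : ∀ x ∈ H, |deriv f x| ≤ K) :
    ∃ L, 0 ≤ L ∧ ∀ x ∈ H, ∀ y ∈ H, |f x - f y| ≤ L * |x - y| := by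
  have hsub : ∀ j, Ioo (c j) (d j) ⊆ H := fun j => hH ▸ subset_iUnion (fun j => Ioo (c j) (d j)) j
  have hopen : IsOpen H := hH ▸ isOpen_iUnion fun j => isOpen_Ioo
  have key : ∀ j k, ∃ L, 0 ≤ L ∧ ∀ x ∈ Ioo (c j) (d j), ∀ y ∈ Ioo (c k) (d k),
      |f x - f y| ≤ L * |x - y| := by
    intro j k
    rcases eq_or_ne j k with rfl | hjk
    · refine ⟨max K 0, le_max_right _ _, fun x hx y hy => ?_⟩
      have := Convex.norm_image_sub_le_of_norm_deriv_le (C := K)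
        (fun z hz => (hasDerivAt_of_contDiffOn hopen hf (hsub j hz)).differentiableAt)
        (fun z hz => hK z (hsub j hz)) (convex_Ioo (c j) (d j)) hy hx
      exact this.trans (mul_le_mul_of_nonneg_right (le_max_left _ _) (norm_nonneg _))
    -- Without a gap, max (c j) (c k) would lie in both closed intervals.
    · have hgap : d j < c k ∨ d k < c j := by
        by_contra! hcon
        refine Set.disjoint_left.1 (hdisj j k hjk)
          (?_ : max (c j) (c k) ∈ Icc (c j) (d j)) ?_
        · exact ⟨le_max_left _ _, max_le (hcd j).le hcon.1⟩
        · exact ⟨le_max_right _ _, max_le hcon.2 (hcd k).le⟩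
      obtain ⟨g, hg, hgle⟩ : ∃ g > 0, ∀ x ∈ Ioo (c j) (d j), ∀ y ∈ Ioo (c k) (d k),
          g ≤ |x - y| := by
        rcases hgap with h | h
        · refine ⟨c k - d j, sub_pos.2 h, fun x hx y hy => ?_⟩
          rw [abs_sub_comm]
          exact (sub_le_sub hy.1.le hx.2.le).trans (le_abs_self _)
        · exact ⟨c j - d k, sub_pos.2 h, fun x hx y hy =>
            (sub_le_sub hx.1.le hy.2.le).trans (le_abs_self _)⟩
      have hM0 : 0 ≤ M := by
        obtain ⟨z, hz⟩ := nonempty_Ioo.2 (hcd j)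
        exact (abs_nonneg _).trans (hM z (hsub j hz))
      -- Across different intervals values differ by at most 2M, while points are at least g apart.
      refine ⟨2 * M / g, by positivity, fun x hx y hy => ?_⟩
      calc |f x - f y| ≤ |f x| + |f y| := abs_sub _ _
        _ ≤ 2 * M := by linarith [hM x (hsub j hx), hM y (hsub k hy)]
        _ = 2 * M / g * g := (div_mul_cancel₀ _ hg.ne').symm
        _ ≤ 2 * M / g * |x - y| := by gcongr; exact hgle x hx y hy
  choose L hL0 hL using key
  refine ⟨∑ j, ∑ k, L j k, Finset.sum_nonneg fun j _ => Finset.sum_nonneg fun k _ => hL0 j k,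
    fun x hx y hy => ?_⟩
  rw [hH] at hx hy
  obtain ⟨j, hj⟩ := mem_iUnion.1 hx
  obtain ⟨k, hk⟩ := mem_iUnion.1 hy
  refine (hL j k x hj y hk).trans (mul_le_mul_of_nonneg_right ?_ (abs_nonneg _))
  exact (Finset.single_le_sum (fun k _ => hL0 j k) (Finset.mem_univ k)).trans
    (Finset.single_le_sum (f := fun j => ∑ k, L j k)
      (fun j _ => Finset.sum_nonneg fun k _ => hL0 j k) (Finset.mem_univ j))

end Intervals

/-! ### Consequences of the hypothesis on the system: finite constants and summability. -/

section Hypothesis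

variable {B : Type*} {H : Set ℝ} {b θ : B → ℝ → ℝ} {m : ℕ}

theorem C_nonneg (hb : ∀ β, ∀ x ∈ H, 0 < b β x) (k : ℕ) : 0 ≤ C H b k := by
  refine Real.sSup_nonneg ?_
  rintro q ⟨β, x, hx, rfl⟩
  exact div_nonneg (abs_nonneg _) (hb β x hx).le

theorem M₀_nonneg : 0 ≤ M₀ H θ := by
  refine Real.sSup_nonneg ?_
  rintro q ⟨β, x, -, rfl⟩
  exact abs_nonneg _

theorem bddAbove_CSet [Fintype B] (hc : IsCompact (closure H)) (hb : ∀ β, IsCm m H (b β))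
    (hpos : ∀ β, ∀ x ∈ closure H, 0 < b β x) {k : ℕ} (hk : k ≤ m) : BddAbove (CSet H b k) := by
  obtain ⟨K, -, hK⟩ := exists_abs_le_of_forall_continuousOn hc
    (F := fun β x => derivBar H k (b β) x / b β x) fun β =>
      ((hb β).continuousOn_derivBar hk).div (hb β).continuousOn fun x hx => (hpos β x hx).ne'
  refine ⟨K, ?_⟩
  rintro q ⟨β, x, hx, rfl⟩
  have := hK β x (subset_closure hx)
  rwa [abs_div, abs_of_pos (hpos β x (subset_closure hx))] at this

theorem bddAbove_M₀Set [Fintype B] (hc : IsCompact (closure H)) (hθ : ∀ β, IsCm m H (θ β))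
    (hm : 2 ≤ m) : BddAbove (M₀Set H θ) := by
  obtain ⟨K, -, hK⟩ := exists_abs_le_of_forall_continuousOn hc
    fun β => (hθ β).continuousOn_derivBar hm
  refine ⟨K, ?_⟩
  rintro q ⟨β, x, hx, rfl⟩
  exact hK β x hx

theorem abs_derivBar_div_le_C {k : ℕ} (hbdd : BddAbove (CSet H b k))
    (hpos : ∀ β, ∀ x ∈ H, 0 < b β x) (β : B) {x : ℝ} (hx : x ∈ H) :
    |derivBar H k (b β) x / b β x| ≤ C H b k := by
  rw [abs_div, abs_of_pos (hpos β x hx)]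
  exact le_csSup hbdd ⟨β, x, hx, rfl⟩

theorem exists_abs_derivBar_div_le (hc : IsCompact (closure H)) {v : ℝ → ℝ} (hv : IsCm m H v)
    (hpos : ∀ x ∈ closure H, 0 < v x) {k : ℕ} (hk : k ≤ m) :
    ∃ K, 0 ≤ K ∧ ∀ x ∈ H, |derivBar H k v x / v x| ≤ K := by
  obtain ⟨K, hK0, hK⟩ := exists_abs_le_of_continuousOn hc
    ((hv.continuousOn_derivBar hk).div hv.continuousOn fun x hx => (hpos x hx).ne')
  exact ⟨K, hK0, fun x hx => hK x (subset_closure hx)⟩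

/-- Under the hypothesis on the system some `ε_μ` is less than `1`. -/
theorem Hypothesis.exists_eps_lt_one (h : Hypothesis m H b θ) : ∃ μ, eps H θ μ < 1 := by
  obtain ⟨μ, hμ, κ, hκ, hcontr⟩ := h.contraction
  -- The given κ may be negative, whereas `eps_le` asks for a nonnegative constant.
  refine ⟨μ, (eps_le (by omega) (le_max_right κ 0) fun ω hω x hx y hy => ?_).trans_lt
    (max_lt hκ one_pos)⟩
  exact (hcontr ω hω x (subset_closure hx) y (subset_closure hy)).trans
    (mul_le_mul_of_nonneg_right (le_max_left _ _) (abs_nonneg _))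

theorem Regular.summable_eps {n : WithTop ℕ∞} (h : Regular n H b θ)
    (hlt : ∃ μ, eps H θ μ < 1) : Summable fun k => eps H θ k :=
  summable_of_submultiplicative eps_nonneg h.eps_add_le hlt.choose_spec

theorem Regular.summable_eps_sq {n : WithTop ℕ∞} (h : Regular n H b θ)
    (hlt : ∃ μ, eps H θ μ < 1) : Summable fun k => eps H θ k ^ 2 := by
  obtain ⟨μ, hμ⟩ := hlt
  refine summable_of_submultiplicative (fun _ => sq_nonneg _) (fun i j => ?_)
    (N := μ) (pow_lt_one₀ (eps_nonneg μ) hμ two_ne_zero)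
  rw [← mul_pow]
  exact pow_le_pow_left₀ (eps_nonneg _) (h.eps_add_le i j) 2

theorem Hypothesis.regular [Fintype B] {n : ℕ} {c d : Fin n → ℝ} (hcd : ∀ j, c j < d j)
    (hdisj : ∀ j k, j ≠ k → Disjoint (Set.Icc (c j) (d j)) (Set.Icc (c k) (d k)))
    (hH : H = ⋃ j, Set.Ioo (c j) (d j)) (hc : IsCompact (closure H)) (hm : 1 ≤ m)
    (h : Hypothesis m H b θ) : Regular m H b θ where
  isOpen := hH ▸ isOpen_iUnion fun j => isOpen_Ioo
  b_contDiffOn β := (h.b_mem β).contDiffOn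
  theta_contDiffOn β := (h.theta_mem β).contDiffOn
  b_pos β x hx := h.b_pos β x (subset_closure hx)
  mapsTo := h.mapsTo
  bddAbove ν := by
    obtain ⟨M, -, hM⟩ := exists_abs_le_of_forall_continuousOn hc
      fun β => (h.theta_mem β).continuousOn
    obtain ⟨K, -, hK⟩ := exists_abs_le_of_forall_continuousOn hc
      fun β => (h.theta_mem β).continuousOn_derivBar hm
    choose L hL0 hL using fun β => exists_lipschitz_of_iUnion_Ioo hcd hdisj hH
      ((h.theta_mem β).contDiffOn_one hm) (fun x hx => hM β x (subset_closure hx))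
      fun x hx => (h.theta_mem β).derivBar_one hm hx ▸ hK β x (subset_closure hx)
    refine bddAbove_epsSet (L := ∑ β, L β) (Finset.sum_nonneg fun β _ => hL0 β) h.mapsTo
      (fun β x hx y hy => (hL β x hx y hy).trans ?_) ν
    exact mul_le_mul_of_nonneg_right
      (Finset.single_le_sum (fun β _ => hL0 β) (Finset.mem_univ β)) (abs_nonneg _)

/-- Positivity of r follows at any point of H: L_s v is there a nonempty sum of positive terms, and
v is positive. -/
theorem Regular.posEigen [Fintype B] [Nonempty B] {n : WithTop ℕ∞} (h : Regular n H b θ)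
    {s r : ℝ} {v : ℝ → ℝ} (hs : 0 < s) (hv : ContDiffOn ℝ n v H) (hpos : ∀ x ∈ H, 0 < v x)
    (heig : ∀ x ∈ H, transferOp b θ s v x = r * v x) (hne : H.Nonempty) :
    PosEigen n H b θ s r v :=
  { h with
    toRegular := h
    s_pos := hs
    r_pos := by
      obtain ⟨x, hx⟩ := hne
      refine pos_of_mul_pos_left ?_ (hpos x hx).le
      rw [← heig x hx]
      exact Finset.sum_pos (fun β _ => mul_pos (Real.rpow_pos_of_pos (h.b_pos β x hx) s)
        (hpos _ (h.mapsTo β hx))) Finset.univ_nonempty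
    v_contDiffOn := hv
    v_pos := hpos
    eigen := heig }

end Hypothesis

end IFS

end

/-! ### The theorem: estimates on H, then passage to the closure. -/

theorem mainTheorem5 {B : Type*} [Fintype B] [Nonempty B]
    (n : ℕ) (c d : Fin n → ℝ) (hcd : ∀ j, c j < d j)
    (hdisj : ∀ j k, j ≠ k → Disjoint (Set.Icc (c j) (d j)) (Set.Icc (c k) (d k)))
    (H : Set ℝ) (hH : H = ⋃ j, Set.Ioo (c j) (d j))
    (m : ℕ) (hm : 1 ≤ m) (b θ : B → ℝ → ℝ) (hIFS : IFS.Hypothesis m H b θ)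
    (s : ℝ) (hs : 0 < s)
    (v : ℝ → ℝ) (hv : IFS.IsCm m H v) (hv_pos : ∀ x ∈ closure H, 0 < v x)
    (r : ℝ) (hv_eig : ∀ x ∈ closure H, IFS.transferOp b θ s v x = r * v x) :
    -- the constants are finite and the series converge
    (∀ ν, 1 ≤ ν → BddAbove (IFS.epsSet H θ ν)) ∧
    Summable (fun k => IFS.eps H θ k) ∧ Summable (fun k => IFS.eps H θ k ^ 2) ∧
    BddAbove (IFS.CSet H b 1) ∧
    -- bound for the first derivative
    (∀ x ∈ closure H,
      |IFS.derivBar H 1 v x| / v x ≤ s * IFS.C H b 1 * ∑' k, IFS.eps H θ k) ∧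
    -- sign of the first derivative
    (∀ δ : ℕ, δ = 0 ∨ δ = 1 →
      (∀ ω : List B, 1 ≤ ω.length → ∀ x ∈ closure H,
        (-1 : ℝ) ^ δ * (IFS.derivBar H 1 (IFS.bWord b θ ω) x / IFS.bWord b θ ω x) ≤ 0) →
      ∀ x ∈ closure H, (-1 : ℝ) ^ δ * IFS.derivBar H 1 v x ≤ 0) ∧
    -- bounds for the second derivative
    (2 ≤ m →
      BddAbove (IFS.CSet H b 2) ∧ BddAbove (IFS.M₀Set H θ) ∧
      ∀ x ∈ closure H,
        IFS.derivBar H 2 v x / v x ≤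
          s ^ 2 * IFS.C H b 1 ^ 2 * (∑' k, IFS.eps H θ k) ^ 2
            + s * (∑' k, IFS.eps H θ k ^ 2) *
              (IFS.C H b 2 + IFS.C H b 1 * IFS.M₀ H θ * ∑' k, IFS.eps H θ k) ∧
        -(s * (∑' k, IFS.eps H θ k ^ 2) *
            ((IFS.C H b 2 + IFS.C H b 1 ^ 2)
              + IFS.C H b 1 * IFS.M₀ H θ * ∑' k, IFS.eps H θ k)) ≤
          IFS.derivBar H 2 v x / v x) := by
  have hc : IsCompact (closure H) := by
    refine Bornology.IsBounded.isCompact_closure ?_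
    rw [hH]
    exact (Bornology.isBounded_iUnion).2 fun j => Metric.isBounded_Ioo _ _
  have hreg := hIFS.regular hcd hdisj hH hc hm
  have hreg1 : IFS.Regular 1 H b θ := hreg.of_le (by exact_mod_cast hm)
  have hlt := hIFS.exists_eps_lt_one
  have hsum := hreg.summable_eps hlt
  have hsum2 := hreg.summable_eps_sq hlt
  have hv_pos' : ∀ x ∈ H, 0 < v x := fun x hx => hv_pos x (subset_closure hx)
  -- H is empty when n = 0, and r is then unconstrained; each use below supplies a point of H.
  have hPE : H.Nonempty → IFS.PosEigen m H b θ s r v := fun hne =>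
    hreg.posEigen hs hv.contDiffOn hv_pos' (fun x hx => hv_eig x (subset_closure hx)) hne
  have hPE1 : H.Nonempty → IFS.PosEigen 1 H b θ s r v := fun hne =>
    (hPE hne).of_le (by exact_mod_cast hm)
  have hC1bdd := IFS.bddAbove_CSet hc hIFS.b_mem hIFS.b_pos hm
  have hC1 : 0 ≤ IFS.C H b 1 := IFS.C_nonneg hreg.b_pos 1
  have h1 : ∀ β, ∀ x ∈ H, |deriv (fun y => Real.log (b β y)) x| ≤ IFS.C H b 1 := fun β x hx => by
    rw [IFS.deriv_log_of_contDiffOn hreg.isOpen (hreg1.b_contDiffOn β) (hreg.b_pos β) hx,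
      ← (hIFS.b_mem β).derivBar_one hm hx]
    exact IFS.abs_derivBar_div_le_C hC1bdd hreg.b_pos β hx
  obtain ⟨K, hK0, hKv⟩ := IFS.exists_abs_derivBar_div_le hc hv hv_pos hm
  have hK : ∀ x ∈ H, |deriv (fun y => Real.log (v y)) x| ≤ K := fun x hx => by
    rw [IFS.deriv_log_of_contDiffOn hreg.isOpen (hv.contDiffOn_one hm) hv_pos' hx,
      ← hv.derivBar_one hm hx]
    exact hKv x hx
  have hD1 := hv.continuousOn_derivBar hm
  refine ⟨fun ν _ => hreg.bddAbove ν, hsum, hsum2, hC1bdd, fun x hx => ?_, ?_, fun hm2 => ?_⟩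
  -- Clearing the denominator leaves two functions continuous on the closure, so it suffices to
  -- compare them on H.
  · rw [div_le_iff₀ (hv_pos x hx)]
    refine IFS.le_on_closure hD1.abs (continuousOn_const.mul hv.continuousOn) (fun y hy => ?_) x hx
    rw [hv.derivBar_one hm hy, mul_assoc s]
    exact (hPE1 ⟨y, hy⟩).abs_deriv_le hsum hC1 h1 hK hy
  · intro δ hδ hsign
    refine IFS.le_on_closure (continuousOn_const.mul hD1) continuousOn_const fun x hx => ?_
    have hsign' : ∀ ω : List B, 1 ≤ ω.length →
        (-1 : ℝ) ^ δ * deriv (fun y => Real.log (IFS.bWord b θ ω y)) x ≤ 0 := fun ω hω => by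
      have hω1 := IFS.contDiffOn_bWord hreg1.b_contDiffOn hreg1.theta_contDiffOn hreg.mapsTo ω
      rw [IFS.deriv_log_of_contDiffOn hreg.isOpen hω1
        (IFS.bWord_pos hreg.b_pos hreg.mapsTo ω) hx,
        ← IFS.derivBar_one_of_contDiffOn hreg.isOpen hω1 hx]
      exact hsign ω hω x (subset_closure hx)
    rw [hv.derivBar_one hm hx]
    rcases hδ with rfl | rfl
    · simpa using (hPE1 ⟨x, hx⟩).deriv_nonpos hsum hK hx (by simpa using hsign')
    · simpa using (hPE1 ⟨x, hx⟩).deriv_nonneg hsum hK hx (by simpa using hsign')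
  · have hreg2 : IFS.Regular 2 H b θ := hreg.of_le (by exact_mod_cast hm2)
    have hPE2 : H.Nonempty → IFS.PosEigen 2 H b θ s r v := fun hne =>
      (hPE hne).of_le (by exact_mod_cast hm2)
    have hC2bdd := IFS.bddAbove_CSet hc hIFS.b_mem hIFS.b_pos hm2
    have hC2 : 0 ≤ IFS.C H b 2 := IFS.C_nonneg hreg.b_pos 2
    have hMbdd := IFS.bddAbove_M₀Set hc hIFS.theta_mem hm2
    have hM : ∀ β, ∀ x ∈ H, |deriv (deriv (θ β)) x| ≤ IFS.M₀ H θ := fun β x hx => by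
      rw [← (hIFS.theta_mem β).derivBar_two hm2 hx]
      exact le_csSup hMbdd ⟨β, x, subset_closure hx, rfl⟩
    have hlog : ∀ β, ∀ x ∈ H, deriv (deriv fun y => Real.log (b β y)) x =
        IFS.derivBar H 2 (b β) x / b β x - (IFS.derivBar H 1 (b β) x / b β x) ^ 2 :=
      fun β x hx => by
        rw [IFS.deriv_deriv_log_of_contDiffOn hreg.isOpen (hreg2.b_contDiffOn β) (hreg.b_pos β) hx,
          (hIFS.b_mem β).derivBar_two hm2 hx, (hIFS.b_mem β).derivBar_one hm hx]
    have h2 : ∀ β, ∀ x ∈ H, deriv (deriv fun y => Real.log (b β y)) x ≤ IFS.C H b 2 :=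
      fun β x hx => by
        rw [hlog β x hx]
        exact (sub_le_self _ (sq_nonneg _)).trans
          (le_of_abs_le (IFS.abs_derivBar_div_le_C hC2bdd hreg.b_pos β hx))
    -- The square (b'/b)² enters (log b)'' with a minus sign: it can be discarded from above but
    -- costs C_1² from below.
    have h2' : ∀ β, ∀ x ∈ H,
        -(IFS.C H b 2 + IFS.C H b 1 ^ 2) ≤ deriv (deriv fun y => Real.log (b β y)) x :=
      fun β x hx => by
        rw [hlog β x hx, neg_add, ← sub_eq_add_neg]
        exact sub_le_sub (neg_le_of_abs_le (IFS.abs_derivBar_div_le_C hC2bdd hreg.b_pos β hx))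
          (sq_le_sq.2 ((IFS.abs_derivBar_div_le_C hC1bdd hreg.b_pos β hx).trans (le_abs_self _)))
    obtain ⟨K₂, hK₂0, hKv₂⟩ := IFS.exists_abs_derivBar_div_le hc hv hv_pos hm2
    have hlogv : ∀ x ∈ H, deriv (deriv fun y => Real.log (v y)) x =
        IFS.derivBar H 2 v x / v x - (IFS.derivBar H 1 v x / v x) ^ 2 := fun x hx => by
      rw [IFS.deriv_deriv_log_of_contDiffOn hreg.isOpen (hv.contDiffOn_two hm2) hv_pos' hx,
        hv.derivBar_two hm2 hx, hv.derivBar_one hm hx]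
    have hKu : ∀ x ∈ H, deriv (deriv fun y => Real.log (v y)) x ≤ K₂ := fun x hx => by
      rw [hlogv x hx]
      exact (sub_le_self _ (sq_nonneg _)).trans (le_of_abs_le (hKv₂ x hx))
    have hKl : ∀ x ∈ H, -(K₂ + K ^ 2) ≤ deriv (deriv fun y => Real.log (v y)) x := fun x hx => by
      rw [hlogv x hx, neg_add, ← sub_eq_add_neg]
      exact sub_le_sub (neg_le_of_abs_le (hKv₂ x hx))
        (sq_le_sq.2 ((hKv x hx).trans (le_abs_self _)))
    have hD2 := hv.continuousOn_derivBar hm2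
    refine ⟨hC2bdd, hMbdd, fun x hx => ⟨?_, ?_⟩⟩
    · rw [div_le_iff₀ (hv_pos x hx)]
      refine IFS.le_on_closure hD2 (continuousOn_const.mul hv.continuousOn) (fun y hy => ?_) x hx
      rw [hv.derivBar_two hm2 hy]
      refine ((hPE2 ⟨y, hy⟩).deriv_deriv_le hsum hsum2 hC1 hC2 IFS.M₀_nonneg hK₂0 hM h1 h2 hK hKu
        hy).trans_eq ?_
      rw [Pi.mul_apply]
      ring
    · rw [le_div_iff₀ (hv_pos x hx)]
      refine IFS.le_on_closure (continuousOn_const.mul hv.continuousOn) hD2 (fun y hy => ?_) x hx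
      rw [hv.derivBar_two hm2 hy]
      -- Here C_2 + C_1² plays the role of C₂, and K₂ + K² that of K'.
      refine Eq.trans_le ?_ ((hPE2 ⟨y, hy⟩).le_deriv_deriv hsum hsum2 hC1
        (add_nonneg hC2 (sq_nonneg _)) IFS.M₀_nonneg (add_nonneg hK₂0 (sq_nonneg _)) hM h1 h2' hK
        hKl hy)
      rw [Pi.mul_apply]
      ring
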